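/- Let $n\ge 1$, $l\ge 1$, and let $\Delta=[e_0,\dots,e_n]\subset\mathbb R^n$ be the standard simplex ($e_0=0$ and $e_1,\dots,e_n$ the canonical basis). For a non-degenerate simplex $V=[v_0,\dots,v_n]$ with barycentric coordinates $\lambda=(\lambda_0,\dots,\lambda_n)$, a polynomial $p$ of degree at most $l$ is written uniquely as $p=\sum_{|\alpha|=l} b_\alpha(p,l,V)\binom{l}{\alpha}\lambda^\alpha$, and the $b_\alpha(p,l,V)$ are its Bernstein coefficients. Put $v_\alpha(V)=\frac1l\sum_i\alpha_i v_i$, and write $\hat e_0,\dots,\hat e_n$ for the canonical basis of $\mathbb N^{n+1}$, with $\hat e_{-1}:=\hat e_n$. Let $$\|\nabla^2p\|_\infty=\max_{|\gamma|=l-2,\ 0\le i<j\le n}\bigl|b_{\gamma+\hat e_i+\hat e_{j-1}}+b_{\gamma+\hat e_{i-1}+\hat e_j}-b_{\gamma+\hat e_{i-1}+\hat e_{j-1}}-b_{\gamma+\hat e_i+\hat e_j}\bigr|,\qquad b_\alpha=b_\alpha(p,l,\Delta)$$ (this is $0$ if $l=1$). Let $f=p/q$, where $p,q$ are real polynomials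 in $n$ variables of degree at most $l$ and $b_\alpha(q,l,\Delta)>0$ for all $|\alpha|=l$. Put $b_\alpha(f,l,V)=b_\alpha(p,l,V)/b_\alpha(q,l,V)$, $\zeta=\max\{|\min_{|\alpha|=l} b_\alpha(f,l,\Delta)|,\ |\max_{|\alpha|=l} b_\alpha(f,l,\Delta)|\}$ and $$\omega'=l\,\frac{n^2(n+1)(n+2)^2(n+3)}{576\,\min_{|\alpha|=l} b_\alpha(q,l,\Delta)}\bigl(\|\nabla^2p\|_\infty+\zeta\,\|\nabla^2q\|_\infty\bigr).$$ A subdivision of a simplex $V$ is a finite list of non-degenerate simplices with union $V$ and pairwise disjoint interiors. A subdivision scheme $S$ assigns to each non-degenerate simplex a subdivision of it; $S^N(\Delta)$ is the list obtained from $\Delta$ by $N$ successive steps. Suppose that $S$ has shrinking factor $C$, where $0<C<1$; that is, every member of $S(V)$ has diameter at most $C\,\mathrm{diam}(V)$, for every $V$. For a list $L$ of simplices let $m_L=\min\{b_\alpha(f,l,V): V\in L,\ |\alpha|=l\}$, and, if $m_L=b_{\alpha^*}(f,l,V^*)$ with $V^*\in L$ and $|\alpha^*|=l$, let $$\delta_L=\min\bigl(\{f(v_{\alpha^*}(V^*))\}\cup\{b_{l\hat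 e_i}(f,l,V): V\in L,\ 0\le i\le n\}\bigr).$$ Let $\varepsilon>0$ and let $N\ge 0$ be an integer with $\dfrac1{C^{2N}}>\dfrac{2\omega'}{\varepsilon}$. Then, for every choice of the minimizer $(V^*,\alpha^*)$, one has $|\delta_L-m_L|<\varepsilon$ for $L=S^N(\Delta)$, and likewise for each one-element list $L=[V]$ with $V\in S^N(\Delta)$. -/

import Mathlib

/-- Polynomial functions of `n` real variables act on points of `ℝⁿ`. -/
noncomputable def evalAt {n : ℕ} (p : MvPolynomial (Fin n) ℝ) (x : EuclideanSpace ℝ (Fin n)) : ℝ :=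
  MvPolynomial.eval (fun j => x j) p

/-- A non-degenerate simplex of `ℝⁿ`: an ordered list of `n + 1` affinely independent points. -/
abbrev RSimplex (n : ℕ) : Type := Affine.Simplex ℝ (EuclideanSpace ℝ (Fin n)) n

/-- The realization `|V|` of a simplex: the convex hull of its vertices. -/
def RSimplex.realization {n : ℕ} (V : RSimplex n) : Set (EuclideanSpace ℝ (Fin n)) :=
  convexHull ℝ (Set.range V.points)

/-- The mesh of a simplex: its diameter. -/
noncomputable def RSimplex.mesh {n : ℕ} (V : RSimplex n) : ℝ := Metric.diam V.realization

/-- The vertices of the standard simplex: the origin and the canonical basis of `ℝⁿ`. -/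
noncomputable def stdVertex (n : ℕ) : Fin (n + 1) → EuclideanSpace ℝ (Fin n) :=
  Fin.cases 0 (fun j => EuclideanSpace.single j 1)

theorem stdVertex_affineIndependent (n : ℕ) : AffineIndependent ℝ (stdVertex n) := by
  rw [affineIndependent_iff_of_fintype]
  intro w hw h
  rw [Finset.univ.weightedVSub_eq_linear_combination hw, Fin.sum_univ_succ] at h
  have hs : ∀ j : Fin n, w j.succ = 0 := by
    intro j
    have := congrArg (fun x : EuclideanSpace ℝ (Fin n) => x j) h
    simpa [stdVertex, Pi.single_apply] using this
  intro i
  refine Fin.cases ?_ hs i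
  rw [Fin.sum_univ_succ] at hw
  simpa [hs] using hw

/-- The standard simplex `Δ = [e₀, e₁, …, eₙ]` of `ℝⁿ`. -/
noncomputable def stdRSimplex (n : ℕ) : RSimplex n := ⟨stdVertex n, stdVertex_affineIndependent n⟩

/-- The form of degree `k` in the barycentric coordinates `X₀, …, Xₙ` with respect to `V` that
represents `p`: in each monomial of `p` the coordinate `x_j` is replaced by `∑ᵢ Xᵢ (vᵢ)_j`, and the
result is multiplied by the power of `∑ᵢ Xᵢ` (which is `1` on barycentric coordinates) that brings
it to degree `k`. Meaningful for `deg p ≤ k`. -/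
noncomputable def baryForm {n : ℕ} (p : MvPolynomial (Fin n) ℝ) (k : ℕ) (V : RSimplex n) :
    MvPolynomial (Fin (n + 1)) ℝ :=
  ∑ β ∈ p.support, MvPolynomial.C (p.coeff β) *
    (∏ j, (∑ i, MvPolynomial.C (V.points i j) * MvPolynomial.X i) ^ (β j)) *
    (∑ i, MvPolynomial.X i) ^ (k - β.degree)

/-- The Bernstein coefficient `b_α(p, k, V)`. The theorems `bernstein_expansion` and
`bernsteinCoeff_unique` say that for `deg p ≤ k` these are the unique coefficients in the
expansion of `p` in the Bernstein polynomials of degree `k` with respect to `V`. -/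
noncomputable def bernsteinCoeff {n : ℕ} (p : MvPolynomial (Fin n) ℝ) (k : ℕ) (V : RSimplex n)
    (α : Fin (n + 1) →₀ ℕ) : ℝ :=
  (baryForm p k V).coeff α / (α.multinomial : ℝ)

/-- The Bernstein polynomial `B_α = multinomial(α) λ^α` as a function of the barycentric
coordinates `λ`. -/
noncomputable def bernsteinPoly {n : ℕ} (α : Fin (n + 1) →₀ ℕ) (lam : Fin (n + 1) → ℝ) : ℝ :=
  (α.multinomial : ℝ) * ∏ i, lam i ^ (α i)

theorem eval_baryForm {n : ℕ} (p : MvPolynomial (Fin n) ℝ) (k : ℕ) (V : RSimplex n)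
    (lam : Fin (n + 1) → ℝ) (hlam : ∑ i, lam i = 1) :
    MvPolynomial.eval lam (baryForm p k V) = evalAt p (∑ i, lam i • V.points i) := by
  rw [evalAt, MvPolynomial.eval_eq' _ p, baryForm, map_sum]
  refine Finset.sum_congr rfl fun β _ => ?_
  have hx : ∀ j, (∑ i, V.points i j * lam i) = (∑ i, lam i • V.points i) j := fun j => by
    simp [mul_comm]
  simp only [map_mul, map_prod, map_pow, map_sum, MvPolynomial.eval_C, MvPolynomial.eval_X, hlam,
    one_pow, mul_one, hx]

theorem baryForm_isHomogeneous {n : ℕ} (p : MvPolynomial (Fin n) ℝ) (k : ℕ)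
    (hp : p.totalDegree ≤ k) (V : RSimplex n) : (baryForm p k V).IsHomogeneous k := by
  refine MvPolynomial.IsHomogeneous.sum _ _ _ fun β hβ => ?_
  have hle : β.degree ≤ k := (MvPolynomial.le_totalDegree hβ).trans hp
  have h1 : (∏ j, (∑ i, MvPolynomial.C (V.points i j) * MvPolynomial.X i) ^ (β j) :
      MvPolynomial (Fin (n + 1)) ℝ).IsHomogeneous (∑ j, β j) := by
    refine MvPolynomial.IsHomogeneous.prod _ _ _ fun j _ => ?_
    have := (MvPolynomial.IsHomogeneous.sum Finset.univ
      (fun i => MvPolynomial.C (V.points i j) * MvPolynomial.X i : Fin (n + 1) →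
        MvPolynomial (Fin (n + 1)) ℝ) 1
      (fun i _ => MvPolynomial.isHomogeneous_C_mul_X _ _)).pow (β j)
    simpa using this
  have h2 := (MvPolynomial.IsHomogeneous.sum Finset.univ
      (fun i => MvPolynomial.X i : Fin (n + 1) → MvPolynomial (Fin (n + 1)) ℝ) 1
      (fun i _ => MvPolynomial.isHomogeneous_X _ _)).pow (k - β.degree)
  have h3 := ((MvPolynomial.isHomogeneous_C (Fin (n + 1)) (p.coeff β)).mul h1).mul h2
  have hd : ∑ j, β j = β.degree := by
    rw [Finsupp.degree_eq_sum]
  convert h3 using 1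
  omega

theorem multinomial_ne_zero {n : ℕ} (α : Fin (n + 1) →₀ ℕ) : (α.multinomial : ℝ) ≠ 0 := by
  rw [Finsupp.multinomial_eq]
  exact_mod_cast (Nat.multinomial_pos _ _).ne'

theorem mem_antidiag_iff {n k : ℕ} (α : Fin (n + 1) →₀ ℕ) :
    α ∈ Finset.finsuppAntidiag Finset.univ k ↔ α.degree = k := by
  simp [Finset.mem_finsuppAntidiag, Finsupp.degree_eq_sum]

/-- The Bernstein expansion: `p = ∑_{|α| = k} b_α(p, k, V) B_α` for `deg p ≤ k`. -/
theorem bernstein_expansion {n : ℕ} (p : MvPolynomial (Fin n) ℝ) (k : ℕ) (hp : p.totalDegree ≤ k)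
    (V : RSimplex n) (lam : Fin (n + 1) → ℝ) (hlam : ∑ i, lam i = 1) :
    evalAt p (∑ i, lam i • V.points i) =
      ∑ α ∈ Finset.finsuppAntidiag Finset.univ k, bernsteinCoeff p k V α * bernsteinPoly α lam := by
  rw [← eval_baryForm p k V lam hlam, MvPolynomial.eval_eq']
  have hsub : (baryForm p k V).support ⊆ Finset.finsuppAntidiag Finset.univ k := by
    intro α hα
    rw [mem_antidiag_iff]
    by_contra hne
    exact (MvPolynomial.mem_support_iff.1 hα)
      ((baryForm_isHomogeneous p k hp V).coeff_eq_zero hne)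
  rw [Finset.sum_subset hsub]
  · refine Finset.sum_congr rfl fun α _ => ?_
    have := multinomial_ne_zero α
    rw [bernsteinCoeff, bernsteinPoly]
    field_simp
  · intro α _ hα
    rw [MvPolynomial.notMem_support_iff.1 hα, zero_mul]

/-- Uniqueness of the Bernstein expansion. -/
theorem bernsteinCoeff_unique {n : ℕ} (p : MvPolynomial (Fin n) ℝ) (k : ℕ)
    (hp : p.totalDegree ≤ k) (V : RSimplex n) (c : (Fin (n + 1) →₀ ℕ) → ℝ)
    (hc : ∀ lam : Fin (n + 1) → ℝ, ∑ i, lam i = 1 → evalAt p (∑ i, lam i • V.points i) =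
      ∑ α ∈ Finset.finsuppAntidiag Finset.univ k, c α * bernsteinPoly α lam)
    (α : Fin (n + 1) →₀ ℕ) (hα : α.degree = k) : c α = bernsteinCoeff p k V α := by
  set Q : MvPolynomial (Fin (n + 1)) ℝ := ∑ α ∈ Finset.finsuppAntidiag Finset.univ k,
    MvPolynomial.monomial α (c α * (α.multinomial : ℝ)) with hQ
  have hQh : Q.IsHomogeneous k := MvPolynomial.IsHomogeneous.sum _ _ _ fun β hβ =>
    MvPolynomial.isHomogeneous_monomial _ ((mem_antidiag_iff β).1 hβ)
  have hPh := baryForm_isHomogeneous p k hp V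
  have hPQ : Q = baryForm p k V := by
    refine MvPolynomial.funext_set (fun _ => Set.Ioi (0 : ℝ)) (fun _ => Set.Ioi_infinite 0) ?_
    intro x hx
    have hpos : 0 < ∑ i, x i :=
      Finset.sum_pos (fun i _ => hx i (Set.mem_univ i)) Finset.univ_nonempty
    set s := ∑ i, x i with hs
    set lam : Fin (n + 1) → ℝ := fun i => x i / s with hl
    have hlam : ∑ i, lam i = 1 := by
      rw [hl, ← Finset.sum_div, ← hs, div_self hpos.ne']
    have hxs : x = s • lam := by
      funext i
      simp only [hl, Pi.smul_apply, smul_eq_mul]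
      field_simp
    have hev : MvPolynomial.eval lam Q = MvPolynomial.eval lam (baryForm p k V) := by
      rw [eval_baryForm p k V lam hlam, hc lam hlam, hQ, map_sum]
      refine Finset.sum_congr rfl fun β _ => ?_
      rw [MvPolynomial.eval_monomial, bernsteinPoly, Finsupp.prod_fintype _ _ (by simp), mul_assoc]
    have key : ∀ R : MvPolynomial (Fin (n + 1)) ℝ, R.IsHomogeneous k →
        MvPolynomial.eval x R = s ^ k * MvPolynomial.eval lam R := by
      intro R hR
      rw [MvPolynomial.eval_eq', MvPolynomial.eval_eq', Finset.mul_sum]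
      refine Finset.sum_congr rfl fun β hβ => ?_
      have hd : ∑ i, β i = k := by
        rw [← Finsupp.degree_eq_sum]
        by_contra hne
        exact (MvPolynomial.mem_support_iff.1 hβ) (hR.coeff_eq_zero hne)
      rw [hxs]
      simp only [Pi.smul_apply, smul_eq_mul, mul_pow, Finset.prod_mul_distrib,
        Finset.prod_pow_eq_pow_sum, hd]
      ring
    rw [key Q hQh, key _ hPh, hev]
  have hco : Q.coeff α = c α * (α.multinomial : ℝ) := by
    classical
    rw [hQ, MvPolynomial.coeff_sum, Finset.sum_eq_single α]
    · simp
    · intro β _ hne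
      simp [hne]
    · intro h
      exact absurd ((mem_antidiag_iff α).2 hα) h
  rw [bernsteinCoeff, ← hPQ, hco, mul_div_assoc, div_self (multinomial_ne_zero α), mul_one]

/-- The grid point `v_α(k, V) = (α₀ v₀ + ⋯ + αₙ vₙ) / k`. -/
noncomputable def gridPoint {n : ℕ} (k : ℕ) (V : RSimplex n) (α : Fin (n + 1) →₀ ℕ) :
    EuclideanSpace ℝ (Fin n) :=
  ∑ i, ((α i : ℝ) / (k : ℝ)) • V.points i

/-- The second difference `∇² b_{γ,i,j}(p, k, V)`, for `|γ| = k - 2`. Subtraction in `Fin (n + 1)`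
is cyclic, so `e_{i-1}` is `eₙ` for `i = 0`. -/
noncomputable def secondDiff {n : ℕ} (p : MvPolynomial (Fin n) ℝ) (k : ℕ) (V : RSimplex n)
    (γ : Fin (n + 1) →₀ ℕ) (i j : Fin (n + 1)) : ℝ :=
  bernsteinCoeff p k V (γ + Finsupp.single i 1 + Finsupp.single (j - 1) 1)
    + bernsteinCoeff p k V (γ + Finsupp.single (i - 1) 1 + Finsupp.single j 1)
    - bernsteinCoeff p k V (γ + Finsupp.single (i - 1) 1 + Finsupp.single (j - 1) 1)
    - bernsteinCoeff p k V (γ + Finsupp.single i 1 + Finsupp.single j 1)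

/-- `‖∇² p‖_∞`, the maximum of the absolute values of the second differences of degree `k` with
respect to `V`. It is a maximum over a finite set; that set is empty for `k < 2`, and then
the value is `0`. -/
noncomputable def secondDiffNorm {n : ℕ} (p : MvPolynomial (Fin n) ℝ) (k : ℕ) (V : RSimplex n) :
    ℝ :=
  sSup {r : ℝ | ∃ (γ : Fin (n + 1) →₀ ℕ) (i j : Fin (n + 1)),
    γ.degree + 2 = k ∧ i < j ∧ r = |secondDiff p k V γ i j|}

/-- The rational Bernstein coefficient `b_α(f, k, V) = b_α(p, k, V) / b_α(q, k, V)` of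
`f = p / q`. -/
noncomputable def ratBernsteinCoeff {n : ℕ} (p q : MvPolynomial (Fin n) ℝ) (k : ℕ)
    (V : RSimplex n) (α : Fin (n + 1) →₀ ℕ) : ℝ :=
  bernsteinCoeff p k V α / bernsteinCoeff q k V α

/-- `ζ`, the larger of the absolute values of the minimal and of the maximal rational Bernstein
coefficient of `f = p / q` of degree `l` over the standard simplex (infimum and supremum are over
finite non-empty sets). -/
noncomputable def zetaConst {n : ℕ} (p q : MvPolynomial (Fin n) ℝ) (l : ℕ) : ℝ :=
  max |sInf (ratBernsteinCoeff p q l (stdRSimplex n) '' {α | α.degree = l})|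
    |sSup (ratBernsteinCoeff p q l (stdRSimplex n) '' {α | α.degree = l})|

/-- The constant `ω'` for the Bernstein degree `l`. -/
noncomputable def omegaPrime {n : ℕ} (p q : MvPolynomial (Fin n) ℝ) (l : ℕ) : ℝ :=
  (l : ℝ) * (((n : ℝ) ^ 2 * ((n : ℝ) + 1) * ((n : ℝ) + 2) ^ 2 * ((n : ℝ) + 3)) /
      (576 * sInf (bernsteinCoeff q l (stdRSimplex n) '' {α | α.degree = l}))) *
    (secondDiffNorm p l (stdRSimplex n) + zetaConst p q l * secondDiffNorm q l (stdRSimplex n))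

/-- A list of simplices is a subdivision of `V` if their realizations cover exactly `|V|` and have
pairwise disjoint interiors. -/
def IsSubdivision {n : ℕ} (V : RSimplex n) (L : List (RSimplex n)) : Prop :=
  (⋃ U ∈ L, U.realization) = V.realization ∧
    L.Pairwise (fun U W => Disjoint (interior U.realization) (interior W.realization))

/-- A subdivision scheme assigns to every non-degenerate simplex a subdivision of it. -/
structure SubdivisionScheme (n : ℕ) where
  /-- the list of subsimplices of one subdivision step -/
  subdiv : RSimplex n → List (RSimplex n)
  isSubdivision : ∀ V, IsSubdivision V (subdiv V)

/-- `S^N(V)`: the list of simplices obtained from `V` by `N` successive subdivision steps. -/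
def SubdivisionScheme.iter {n : ℕ} (S : SubdivisionScheme n) : ℕ → RSimplex n → List (RSimplex n)
  | 0, V => [V]
  | N + 1, V => (S.iter N V).flatMap S.subdiv

/-- `S` has shrinking factor `C`, where `0 < C < 1`: one step reduces the mesh of every simplex at
least by the factor `C`. -/
def SubdivisionScheme.HasShrinkingFactor {n : ℕ} (S : SubdivisionScheme n) (C : ℝ) : Prop :=
  0 < C ∧ C < 1 ∧ ∀ V : RSimplex n, ∀ U ∈ S.subdiv V, U.mesh ≤ C * V.mesh

/-- The minimal rational Bernstein coefficient `m` of `f = p / q` of degree `l` over a list of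
simplices (a minimum over a finite set). -/
noncomputable def minCoeff {n : ℕ} (p q : MvPolynomial (Fin n) ℝ) (l : ℕ)
    (L : List (RSimplex n)) : ℝ :=
  sInf {r : ℝ | ∃ V ∈ L, ∃ α : Fin (n + 1) →₀ ℕ, α.degree = l ∧ r = ratBernsteinCoeff p q l V α}

/-- The upper estimate `δ` of `f = p / q` over a list `L` of simplices, where `V ∈ L` and the
multi-index `α` are a place at which the minimal coefficient is attained: the minimum of
`f(v_α(l, V))` and of all the vertex coefficients `b_{l eᵢ}(f, l, U)`, for `U ∈ L`. -/
noncomputable def upperEstimate {n : ℕ} (p q : MvPolynomial (Fin n) ℝ) (l : ℕ)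
    (L : List (RSimplex n)) (V : RSimplex n) (α : Fin (n + 1) →₀ ℕ) : ℝ :=
  min (evalAt p (gridPoint l V α) / evalAt q (gridPoint l V α))
    (sInf {r : ℝ | ∃ U ∈ L, ∃ i : Fin (n + 1),
      r = ratBernsteinCoeff p q l U (Finsupp.single i l)})

/-! Let `Λ_p` be the linear functional on forms of degree `l` with `X^α ↦ b_α(p, l, Δ)`, and let
`w_x` be the linear form whose coefficients are the barycentric coordinates of `x` with respect to
`Δ`. This is the blossom of `p`: `Λ_p (w_x ^ l) = p(x)`, and `Λ_p (∏ w_{v_i} ^ α_i) = b_α(p, l, V)`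
for every simplex `V`. Hence coefficient minus grid value is `Λ_p` of a product of `l` linear forms
minus `Λ_p` of the `l`-th power of their mean.

Averaging over permutations of the factors (`sum_mul_sum_perm_prod`) bounds this difference by `(l -
1) / 4` times a bound for `|Λ_p (G (w_x - w_y)^2)|`, where `x`, `y` are vertices of `V` and `G` is a
convex combination of monomials of degree `l - 2` (`abs_apply_prod_sub_pow_le`). In the cyclic
directions `X_i - X_{i-1}`, which sum to zero, the square becomes a combination of mixed products
only, so the second differences with `i ≠ j` suffice, and the bound is `n^2 (n+1) / 2 * dist x y ^ 2
* ‖∇²p‖`.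

For `V` in `S^N(Δ)` the squared distances are at most `C^(2N) diam(Δ)^2`. Dividing by `q` costs the
factor `ζ` on the error of `q`, and the denominator is at least `min b_α(q, l, Δ)`. The constant in
`ω'` then suffices because `36 diam(Δ)^2 ≤ (n+2)^2 (n+3)`. Finally `m_L ≤ δ_L ≤ f(v_{α*})` traps the
gap between `0` and the error at the minimizing coefficient. -/

/-! ### The blossom over the standard simplex -/

/-- The linear functional on forms in the barycentric coordinates that sends `X^α` to
`b_α(p, k, V)`. -/
noncomputable def bernsteinFunctional {n : ℕ} (p : MvPolynomial (Fin n) ℝ) (k : ℕ)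
    (V : RSimplex n) : MvPolynomial (Fin (n + 1)) ℝ →ₗ[ℝ] ℝ :=
  (MvPolynomial.basisMonomials (Fin (n + 1)) ℝ).constr ℝ (bernsteinCoeff p k V)

theorem bernsteinFunctional_monomial {n : ℕ} (p : MvPolynomial (Fin n) ℝ) (k : ℕ)
    (V : RSimplex n) (α : Fin (n + 1) →₀ ℕ) (c : ℝ) :
    bernsteinFunctional p k V (MvPolynomial.monomial α c) = c * bernsteinCoeff p k V α := by
  have h1 : MvPolynomial.monomial α c = c • MvPolynomial.basisMonomials (Fin (n + 1)) ℝ α := by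
    simp [MvPolynomial.smul_monomial]
  rw [h1, map_smul, bernsteinFunctional, Module.Basis.constr_basis, smul_eq_mul]

theorem linearMap_eq_sum_support {σ : Type*} (Λ : MvPolynomial σ ℝ →ₗ[ℝ] ℝ)
    (G : MvPolynomial σ ℝ) :
    Λ G = ∑ γ ∈ G.support, G.coeff γ * Λ (MvPolynomial.monomial γ 1) := by
  conv_lhs => rw [G.as_sum]
  rw [map_sum]
  refine Finset.sum_congr rfl fun γ _ => ?_
  rw [← smul_eq_mul, ← map_smul, MvPolynomial.smul_monomial, smul_eq_mul, mul_one]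

/-- The multinomial theorem, indexed by finitely supported exponents. -/
theorem sum_pow_eq_sum_finsuppAntidiag {ι R : Type*} [Fintype ι] [DecidableEq ι] [CommSemiring R]
    (f : ι → R) (k : ℕ) :
    (∑ i, f i) ^ k = ∑ α ∈ Finset.finsuppAntidiag Finset.univ k,
      (α.multinomial : R) * ∏ i, f i ^ α i := by
  rw [Finset.sum_pow_eq_sum_piAntidiag]
  refine Finset.sum_bij' (fun (α : ι → ℕ) _ => Finsupp.equivFunOnFinite.symm α)
    (fun (α : ι →₀ ℕ) _ => (α : ι → ℕ)) ?_ ?_ ?_ ?_ ?_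
  · intro α hα
    simpa [Finset.mem_finsuppAntidiag] using hα
  · intro α hα
    simpa [Finset.mem_finsuppAntidiag] using hα
  · intro α _
    rfl
  · intro α _
    ext
    rfl
  · intro α _
    rw [Finsupp.multinomial_eq_of_support_subset (Finset.subset_univ _)]
    rfl

/-- The barycentric form of a point `x` with respect to the standard simplex: its coefficients are
the barycentric coordinates of `x`. -/
noncomputable def pointForm {n : ℕ} (x : EuclideanSpace ℝ (Fin n)) :
    MvPolynomial (Fin (n + 1)) ℝ :=
  MvPolynomial.X 0 + ∑ j, x j • (MvPolynomial.X j.succ - MvPolynomial.X 0)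

/-- The barycentric coordinates of a point with respect to the standard simplex. -/
noncomputable def stdCoord {n : ℕ} (x : EuclideanSpace ℝ (Fin n)) : Fin (n + 1) → ℝ :=
  Fin.cons (1 - ∑ j, x j) (fun j => x j)

theorem sum_stdCoord {n : ℕ} (x : EuclideanSpace ℝ (Fin n)) : ∑ i, stdCoord x i = 1 := by
  simp [stdCoord, Fin.sum_univ_succ]

theorem sum_stdCoord_smul {n : ℕ} (x : EuclideanSpace ℝ (Fin n)) :
    ∑ i, stdCoord x i • (stdRSimplex n).points i = x := by
  ext j
  simp [stdCoord, Fin.sum_univ_succ, stdRSimplex, stdVertex, Pi.single_apply]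

theorem pointForm_eq_sum {n : ℕ} (x : EuclideanSpace ℝ (Fin n)) :
    pointForm x = ∑ i, stdCoord x i • MvPolynomial.X i := by
  simp only [pointForm, stdCoord, Fin.sum_univ_succ, Fin.cons_zero, Fin.cons_succ, smul_sub,
    Finset.sum_sub_distrib, sub_smul, one_smul, ← Finset.sum_smul]
  abel

/-- `pointForm` is affine rather than linear: the weights must sum to `1` to reproduce the constant
term `X 0`. -/
theorem pointForm_sum_smul {n : ℕ} {ι : Type*} [Fintype ι] (c : ι → ℝ) (hc : ∑ i, c i = 1)
    (v : ι → EuclideanSpace ℝ (Fin n)) :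
    pointForm (∑ i, c i • v i) = ∑ i, c i • pointForm (v i) := by
  simp only [pointForm, smul_add, Finset.sum_add_distrib, ← Finset.sum_smul, hc, one_smul,
    Finset.smul_sum, smul_smul]
  rw [Finset.sum_comm]
  simp [Finset.sum_smul]

/-- The multinomial expansion of the power has the Bernstein polynomials at `x` as its coefficients,
so the functional turns it into the Bernstein expansion. This is the diagonal of the blossom. -/
theorem bernsteinFunctional_pointForm_pow {n : ℕ} (p : MvPolynomial (Fin n) ℝ) (k : ℕ)
    (hp : p.totalDegree ≤ k) (x : EuclideanSpace ℝ (Fin n)) :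
    bernsteinFunctional p k (stdRSimplex n) (pointForm x ^ k) = evalAt p x := by
  conv_rhs => rw [← sum_stdCoord_smul x]
  rw [bernstein_expansion p k hp _ _ (sum_stdCoord x), pointForm_eq_sum,
    sum_pow_eq_sum_finsuppAntidiag, map_sum]
  refine Finset.sum_congr rfl fun α _ => ?_
  have h : ((α.multinomial : MvPolynomial (Fin (n + 1)) ℝ) *
      ∏ i, (stdCoord x i • MvPolynomial.X i : MvPolynomial (Fin (n + 1)) ℝ) ^ α i)
      = MvPolynomial.monomial α (bernsteinPoly α (stdCoord x)) := by
    rw [MvPolynomial.monomial_eq, bernsteinPoly, Finsupp.prod_fintype _ _ (by simp)]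
    simp [MvPolynomial.smul_eq_C_mul, mul_pow, Finset.prod_mul_distrib, mul_assoc]
  rw [h, bernsteinFunctional_monomial, mul_comm]

/-- The Bernstein coefficients over any simplex, through the blossom over the standard one. -/
theorem bernsteinFunctional_prod_pointForm {n : ℕ} (p : MvPolynomial (Fin n) ℝ) (k : ℕ)
    (hp : p.totalDegree ≤ k) (V : RSimplex n) (α : Fin (n + 1) →₀ ℕ) (hα : α.degree = k) :
    bernsteinFunctional p k (stdRSimplex n) (∏ i, pointForm (V.points i) ^ α i)
      = bernsteinCoeff p k V α := by
  -- Expanding the `k`-th power of `∑ lam i • pointForm (V.points i)` exhibits these values as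
  -- coefficients of a Bernstein expansion of `p` over `V`; uniqueness identifies them.
  refine bernsteinCoeff_unique p k hp V (fun α => bernsteinFunctional p k (stdRSimplex n)
    (∏ i, pointForm (V.points i) ^ α i)) (fun lam hlam => ?_) α hα
  rw [← bernsteinFunctional_pointForm_pow p k hp, pointForm_sum_smul lam hlam,
    sum_pow_eq_sum_finsuppAntidiag, map_sum]
  refine Finset.sum_congr rfl fun β _ => ?_
  have h : ((β.multinomial : MvPolynomial (Fin (n + 1)) ℝ) *
      ∏ i, (lam i • pointForm (V.points i)) ^ β i)
      = bernsteinPoly β lam • ∏ i, pointForm (V.points i) ^ β i := by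
    rw [bernsteinPoly]
    simp [MvPolynomial.smul_eq_C_mul, mul_pow, Finset.prod_mul_distrib, mul_assoc]
  rw [h, map_smul, smul_eq_mul, mul_comm]

/-! ### Convex forms and enclosure of linear functionals -/

/-- A form of degree `k` that is a convex combination of the monomials of degree `k`. -/
structure IsConvexForm {σ : Type*} (k : ℕ) (G : MvPolynomial σ ℝ) : Prop where
  isHomogeneous : G.IsHomogeneous k
  coeff_nonneg : ∀ γ, 0 ≤ G.coeff γ
  eval_one : MvPolynomial.eval (fun _ => (1 : ℝ)) G = 1

namespace IsConvexForm

variable {σ : Type*} {k m : ℕ} {G H : MvPolynomial σ ℝ}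

theorem one : IsConvexForm 0 (1 : MvPolynomial σ ℝ) := by
  classical
  refine ⟨MvPolynomial.isHomogeneous_one _ _, fun γ => ?_, by simp⟩
  rw [MvPolynomial.coeff_one]
  split_ifs <;> norm_num

theorem X (i : σ) : IsConvexForm 1 (MvPolynomial.X i : MvPolynomial σ ℝ) := by
  classical
  refine ⟨MvPolynomial.isHomogeneous_X _ _, fun γ => ?_, by simp⟩
  rw [MvPolynomial.coeff_X]
  split_ifs <;> norm_num

theorem mul (hG : IsConvexForm k G) (hH : IsConvexForm m H) : IsConvexForm (k + m) (G * H) := by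
  classical
  refine ⟨hG.isHomogeneous.mul hH.isHomogeneous, fun γ => ?_, by
    rw [map_mul, hG.eval_one, hH.eval_one, one_mul]⟩
  rw [MvPolynomial.coeff_mul]
  exact Finset.sum_nonneg fun x _ => mul_nonneg (hG.coeff_nonneg _) (hH.coeff_nonneg _)

theorem sum_smul {ι : Type*} [Fintype ι] (c : ι → ℝ) (hc : ∀ i, 0 ≤ c i) (hs : ∑ i, c i = 1)
    (F : ι → MvPolynomial σ ℝ) (hF : ∀ i, IsConvexForm k (F i)) :
    IsConvexForm k (∑ i, c i • F i) := by
  refine ⟨MvPolynomial.IsHomogeneous.sum _ _ _ fun i _ => ?_, fun γ => ?_, ?_⟩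
  · have := (MvPolynomial.isHomogeneous_C σ (c i)).mul (hF i).isHomogeneous
    rwa [zero_add, ← MvPolynomial.smul_eq_C_mul] at this
  · rw [MvPolynomial.coeff_sum]
    exact Finset.sum_nonneg fun i _ => by
      rw [MvPolynomial.coeff_smul]; exact mul_nonneg (hc i) ((hF i).coeff_nonneg γ)
  · simp [MvPolynomial.smul_eval, (hF _).eval_one, hs]

theorem prod {ι : Type*} [DecidableEq ι] (A : Finset ι) (w : ι → MvPolynomial σ ℝ)
    (hw : ∀ i ∈ A, IsConvexForm 1 (w i)) : IsConvexForm A.card (∏ i ∈ A, w i) := by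
  induction A using Finset.induction_on with
  | empty => simpa using one
  | insert r A hr ih =>
    rw [Finset.prod_insert hr, Finset.card_insert_of_notMem hr, add_comm]
    exact (hw r (by simp)).mul (ih fun i hi => hw i (by simp [hi]))

theorem pow (hG : IsConvexForm 1 G) (k : ℕ) : IsConvexForm k (G ^ k) := by
  simpa using prod (Finset.range k) (fun _ => G) fun _ _ => hG

theorem sum_coeff (hG : IsConvexForm k G) : ∑ γ ∈ G.support, G.coeff γ = 1 := by
  have := hG.eval_one
  rw [MvPolynomial.eval_eq] at this
  simpa using this

theorem degree_eq (hG : IsConvexForm k G) {γ : σ →₀ ℕ} (hγ : γ ∈ G.support) : γ.degree = k := by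
  by_contra hne
  exact (MvPolynomial.mem_support_iff.1 hγ) (hG.isHomogeneous.coeff_eq_zero hne)

/-- The value at `G` is a weighted mean of the values at monomials; every enclosure property below
comes from this. -/
theorem le_apply (hG : IsConvexForm k G) (Λ : MvPolynomial σ ℝ →ₗ[ℝ] ℝ) (B : ℝ)
    (hB : ∀ γ : σ →₀ ℕ, γ.degree = k → B ≤ Λ (MvPolynomial.monomial γ 1)) : B ≤ Λ G := by
  rw [linearMap_eq_sum_support]
  calc B = ∑ γ ∈ G.support, G.coeff γ * B := by rw [← Finset.sum_mul, hG.sum_coeff, one_mul]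
    _ ≤ _ := Finset.sum_le_sum fun γ hγ =>
      mul_le_mul_of_nonneg_left (hB γ (hG.degree_eq hγ)) (hG.coeff_nonneg γ)

theorem abs_apply_le (hG : IsConvexForm k G) (Λ : MvPolynomial σ ℝ →ₗ[ℝ] ℝ) (B : ℝ)
    (hB : ∀ γ : σ →₀ ℕ, γ.degree = k → |Λ (MvPolynomial.monomial γ 1)| ≤ B) : |Λ G| ≤ B := by
  rw [abs_le]
  refine ⟨hG.le_apply Λ _ fun γ hγ => (abs_le.1 (hB γ hγ)).1, ?_⟩
  have := hG.le_apply (-Λ) (-B) fun γ hγ => by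
    simpa using (abs_le.1 (hB γ hγ)).2
  simpa using this

end IsConvexForm

/-- The points with nonnegative barycentric coordinates form a convex set containing the vertices,
hence the whole simplex. -/
theorem isConvexForm_pointForm {n : ℕ} (x : EuclideanSpace ℝ (Fin n))
    (hx : x ∈ (stdRSimplex n).realization) : IsConvexForm 1 (pointForm x) := by
  have hsub : (stdRSimplex n).realization ⊆
      {x : EuclideanSpace ℝ (Fin n) | ∀ i, 0 ≤ stdCoord x i} := by
    refine convexHull_min ?_ ?_
    · rintro _ ⟨i, rfl⟩ j
      refine Fin.cases ?_ (fun i => ?_) i <;> refine Fin.cases ?_ (fun j => ?_) j <;>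
        simp [stdRSimplex, stdVertex, stdCoord]
      split_ifs <;> norm_num
    · intro x hx y hy a b ha hb hab i
      have : stdCoord (a • x + b • y) i = a * stdCoord x i + b * stdCoord y i := by
        refine Fin.cases ?_ (fun j => ?_) i
        · simp only [stdCoord, Fin.cons_zero, PiLp.add_apply, PiLp.smul_apply, smul_eq_mul,
            Finset.sum_add_distrib, ← Finset.mul_sum]
          linear_combination -hab
        · simp [stdCoord]
      rw [this]
      exact add_nonneg (mul_nonneg ha (hx i)) (mul_nonneg hb (hy i))
  rw [pointForm_eq_sum]
  exact IsConvexForm.sum_smul _ (hsub hx) (sum_stdCoord x) _ IsConvexForm.X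

/-! ### Comparing a product of linear forms with a power of their mean -/

/-- Averaging over all rearrangements: multiplying a mean of partial products by the sum of all
factors, instead of by one further factor, costs only squares of differences. -/
theorem sum_mul_sum_perm_prod {ι R : Type*} [Fintype ι] [DecidableEq ι] [CommRing R]
    (w : ι → R) (A : Finset ι) (r : ι) (hr : r ∉ A) :
    2 * ((∑ i, w i) * ∑ σ : Equiv.Perm ι, ∏ k ∈ A, w (σ k)) =
      2 * (Fintype.card ι * ∑ σ : Equiv.Perm ι, ∏ k ∈ insert r A, w (σ k)) +
      ∑ m ∈ A, ∑ σ : Equiv.Perm ι,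
        (∏ k ∈ A.erase m, w (σ k)) * (w (σ m) - w (σ r)) ^ 2 := by
  have hF : ∀ m, m ∉ A → ∑ σ : Equiv.Perm ι, (∏ k ∈ A, w (σ k)) * w (σ m) =
      ∑ σ : Equiv.Perm ι, ∏ k ∈ insert r A, w (σ k) := by
    intro m hm
    -- Precomposing `σ` with the transposition of `r` and `m` permutes the summation range and fixes
    -- the factors indexed by `A`.
    rw [← Equiv.sum_comp (Equiv.mulRight (Equiv.swap r m))]
    refine Finset.sum_congr rfl fun σ _ => ?_
    rw [Finset.prod_insert hr, mul_comm]
    simp only [Equiv.coe_mulRight, Equiv.Perm.mul_apply, Equiv.swap_apply_right]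
    congr 1
    refine Finset.prod_congr rfl fun k hk => ?_
    rw [Equiv.swap_apply_of_ne_of_ne (ne_of_mem_of_not_mem hk hr) (ne_of_mem_of_not_mem hk hm)]
  have hA : ∀ m ∈ A, 2 * ∑ σ : Equiv.Perm ι, (∏ k ∈ A, w (σ k)) * w (σ m) =
      2 * (∑ σ : Equiv.Perm ι, ∏ k ∈ insert r A, w (σ k)) + ∑ σ : Equiv.Perm ι,
        (∏ k ∈ A.erase m, w (σ k)) * (w (σ m) - w (σ r)) ^ 2 := by
    intro m hm
    have h1 : ∑ σ : Equiv.Perm ι, (∏ k ∈ A, w (σ k)) * w (σ m) =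
        ∑ σ : Equiv.Perm ι, (∏ k ∈ A.erase m, w (σ k)) * w (σ m) ^ 2 :=
      Finset.sum_congr rfl fun σ _ => by rw [← Finset.mul_prod_erase A _ hm]; ring
    have h2 : ∑ σ : Equiv.Perm ι, (∏ k ∈ A.erase m, w (σ k)) * w (σ m) ^ 2 =
        ∑ σ : Equiv.Perm ι, (∏ k ∈ A.erase m, w (σ k)) * w (σ r) ^ 2 := by
      rw [← Equiv.sum_comp (Equiv.mulRight (Equiv.swap r m))]
      refine Finset.sum_congr rfl fun σ _ => ?_
      simp only [Equiv.coe_mulRight, Equiv.Perm.mul_apply, Equiv.swap_apply_right]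
      congr 1
      refine Finset.prod_congr rfl fun k hk => ?_
      rw [Equiv.swap_apply_of_ne_of_ne (ne_of_mem_of_not_mem (Finset.mem_of_mem_erase hk) hr)
        (Finset.ne_of_mem_erase hk)]
    rw [two_mul, h1]
    -- Only one of the two copies is moved from `σ m` to `σ r`, so that `a^2 + b^2 = 2ab + (a -
    -- b)^2` applies.
    nth_rewrite 2 [h2]
    rw [Finset.mul_sum, ← Finset.sum_add_distrib, ← Finset.sum_add_distrib]
    refine Finset.sum_congr rfl fun σ _ => ?_
    rw [Finset.prod_insert hr, ← Finset.mul_prod_erase A _ hm]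
    ring
  have hswap : (∑ i, w i) * ∑ σ : Equiv.Perm ι, ∏ k ∈ A, w (σ k) =
      ∑ m, ∑ σ : Equiv.Perm ι, (∏ k ∈ A, w (σ k)) * w (σ m) := by
    rw [Finset.sum_comm, Finset.mul_sum]
    refine Finset.sum_congr rfl fun σ _ => ?_
    rw [← Finset.mul_sum, Equiv.sum_comp σ w, mul_comm]
  rw [hswap, ← Finset.sum_add_sum_compl A, mul_add, Finset.mul_sum, Finset.sum_congr rfl hA,
    Finset.sum_add_distrib, Finset.sum_congr rfl fun m hm => hF m (Finset.mem_compl.1 hm),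
    Finset.sum_const, Finset.sum_const, Finset.card_compl, nsmul_eq_mul, nsmul_eq_mul,
    Nat.cast_sub (Finset.card_le_univ A)]
  ring

/-- A product of convex linear forms differs from the corresponding power of their mean `s` by at
most a quarter of the number of factors times a bound for the second differences. -/
theorem abs_apply_prod_sub_pow_le {σ ι : Type*} [Fintype ι] [DecidableEq ι] [Nonempty ι]
    (Λ : MvPolynomial σ ℝ →ₗ[ℝ] ℝ) (w : ι → MvPolynomial σ ℝ) (hw : ∀ i, IsConvexForm 1 (w i))
    (s : MvPolynomial σ ℝ) (hs : IsConvexForm 1 s) (hsum : ∑ i, w i = (Fintype.card ι : ℝ) • s)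
    (K : ℝ) (hK : ∀ (k : ℕ) (G : MvPolynomial σ ℝ) (i j : ι), k + 2 = Fintype.card ι →
      IsConvexForm k G → |Λ (G * (w i - w j) ^ 2)| ≤ K) :
    |Λ (∏ i, w i) - Λ (s ^ Fintype.card ι)| ≤ ((Fintype.card ι : ℝ) - 1) / 4 * K := by
  set l := Fintype.card ι with hl
  have hl0 : (0 : ℝ) < l := by exact_mod_cast Fintype.card_pos
  set P : ℝ := (Fintype.card (Equiv.Perm ι) : ℝ) with hP
  have hP0 : 0 < P := by rw [hP]; exact_mod_cast Fintype.card_pos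
  -- Factors are replaced by `s` one at a time. Passing from `a` to `a + 1` genuine factors costs `a
  -- / (2l) * P * K`, and summing these costs gives `a(a-1) / (4l)`. The case `A = ∅` is exact, and
  -- `a = l` gives `(l-1) / 4`.
  have key : ∀ A : Finset ι, ∀ e, A.card + e = l →
      |Λ (s ^ e * ∑ σ : Equiv.Perm ι, ∏ k ∈ A, w (σ k)) - P * Λ (s ^ l)|
        ≤ P * ((A.card : ℝ) * ((A.card : ℝ) - 1) / (4 * l) * K) := by
    intro A
    induction A using Finset.induction_on with
    | empty =>
      intro e he
      have he : e = l := by simpa using he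
      subst he
      have : s ^ l * ∑ σ : Equiv.Perm ι, ∏ k ∈ (∅ : Finset ι), w (σ k) = P • s ^ l := by
        simp [hP, MvPolynomial.smul_eq_C_mul, mul_comm]
      rw [this]
      simp
    | insert r A hr ih =>
      intro e he
      rw [Finset.card_insert_of_notMem hr] at he ⊢
      have h1 := ih (e + 1) (by omega)
      have hid := sum_mul_sum_perm_prod w A r hr
      rw [hsum, ← hl] at hid
      set F := ∑ σ : Equiv.Perm ι, ∏ k ∈ A, w (σ k) with hF
      set F' := ∑ σ : Equiv.Perm ι, ∏ k ∈ insert r A, w (σ k) with hF'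
      set E := ∑ m ∈ A, ∑ σ : Equiv.Perm ι,
        (∏ k ∈ A.erase m, w (σ k)) * (w (σ m) - w (σ r)) ^ 2 with hE
      have hid2 : (2 * l : ℝ) • (s ^ (e + 1) * F) = (2 * l : ℝ) • (s ^ e * F') + s ^ e * E := by
        have hl' : (MvPolynomial.C (l : ℝ) : MvPolynomial σ ℝ) = (l : MvPolynomial σ ℝ) := by simp
        have h2' : (MvPolynomial.C (2 : ℝ) : MvPolynomial σ ℝ) = 2 := by
          exact_mod_cast (map_ofNat MvPolynomial.C 2)
        rw [MvPolynomial.smul_eq_C_mul] at hid ⊢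
        rw [MvPolynomial.smul_eq_C_mul, map_mul, h2']
        rw [hl'] at hid ⊢
        linear_combination s ^ e * hid
      have hΛ : 2 * l * Λ (s ^ (e + 1) * F) = 2 * l * Λ (s ^ e * F') + Λ (s ^ e * E) := by
        have := congrArg Λ hid2
        rwa [map_add, map_smul, map_smul, smul_eq_mul, smul_eq_mul] at this
      have hEb : |Λ (s ^ e * E)| ≤ A.card * (P * K) := by
        rw [hE, Finset.mul_sum, map_sum]
        refine (Finset.abs_sum_le_sum_abs _ _).trans ?_
        rw [← nsmul_eq_mul]
        refine Finset.sum_le_card_nsmul _ _ _ fun m hm => ?_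
        rw [Finset.mul_sum, map_sum]
        refine (Finset.abs_sum_le_sum_abs _ _).trans ?_
        rw [hP, ← nsmul_eq_mul]
        refine Finset.sum_le_card_nsmul _ _ _ fun σ _ => ?_
        rw [← mul_assoc]
        refine hK (e + (A.erase m).card) _ _ _ ?_ ((hs.pow e).mul
          (IsConvexForm.prod _ _ fun i _ => hw _))
        rw [Finset.card_erase_of_mem hm]
        have := Finset.card_pos.2 ⟨m, hm⟩
        omega
      have h2 : Λ (s ^ e * F') - P * Λ (s ^ l)
          = (Λ (s ^ (e + 1) * F) - P * Λ (s ^ l)) - Λ (s ^ e * E) / (2 * l) := by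
        field_simp
        linarith
      rw [h2]
      refine (abs_sub _ _).trans ?_
      rw [abs_div, abs_of_pos (by positivity : (0 : ℝ) < 2 * l)]
      have h3 : |Λ (s ^ e * E)| / (2 * l) ≤ A.card * (P * K) / (2 * l) := by gcongr
      refine (add_le_add h1 h3).trans (le_of_eq ?_)
      push_cast
      field_simp
      ring
  have h := key Finset.univ 0 (by simp [hl])
  have hprod : ∑ σ : Equiv.Perm ι, ∏ k, w (σ k) = P • ∏ k, w k := by
    simp [Equiv.prod_comp, hP, MvPolynomial.smul_eq_C_mul]
  rw [hprod, pow_zero, one_mul, map_smul, smul_eq_mul, ← mul_sub, abs_mul, abs_of_pos hP0,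
    Finset.card_univ, ← hl] at h
  refine (le_of_mul_le_mul_left h hP0).trans (le_of_eq ?_)
  field_simp

/-! ### Second differences as values of the functional -/

theorem finite_setOf_degree_eq {ι : Type*} [Fintype ι] [DecidableEq ι] (k : ℕ) :
    {α : ι →₀ ℕ | α.degree = k}.Finite := by
  refine (Finset.finsuppAntidiag (Finset.univ : Finset ι) k).finite_toSet.subset fun α hα => ?_
  simpa [Finset.mem_finsuppAntidiag, Finsupp.degree_eq_sum] using hα

theorem bernsteinFunctional_monomial_mul_sub_mul_sub {n : ℕ} (p : MvPolynomial (Fin n) ℝ) (k : ℕ)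
    (V : RSimplex n) (γ : Fin (n + 1) →₀ ℕ) (i j : Fin (n + 1)) :
    bernsteinFunctional p k V (MvPolynomial.monomial γ 1 *
      ((MvPolynomial.X i - MvPolynomial.X (i - 1)) * (MvPolynomial.X j - MvPolynomial.X (j - 1))))
      = -secondDiff p k V γ i j := by
  have h : ∀ a b : Fin (n + 1), bernsteinFunctional p k V
      (MvPolynomial.monomial γ 1 * (MvPolynomial.X a * MvPolynomial.X b))
      = bernsteinCoeff p k V (γ + Finsupp.single a 1 + Finsupp.single b 1) := by
    intro a b
    simp [MvPolynomial.X, MvPolynomial.monomial_mul, bernsteinFunctional_monomial, add_assoc]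
  simp only [mul_sub, sub_mul, map_sub, h, secondDiff]
  ring

/-- The product of the two cyclic differences commutes. This extends the bound by `secondDiffNorm`
from `i < j` to `i ≠ j`. -/
theorem secondDiff_comm {n : ℕ} (p : MvPolynomial (Fin n) ℝ) (k : ℕ)
    (V : RSimplex n) (γ : Fin (n + 1) →₀ ℕ) (i j : Fin (n + 1)) :
    secondDiff p k V γ i j = secondDiff p k V γ j i := by
  simp only [← neg_inj (a := secondDiff p k V γ i j),
    ← bernsteinFunctional_monomial_mul_sub_mul_sub, mul_comm (MvPolynomial.X i - _)]

theorem bddAbove_secondDiff {n : ℕ} (p : MvPolynomial (Fin n) ℝ) (k : ℕ) (V : RSimplex n) :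
    BddAbove {r : ℝ | ∃ (γ : Fin (n + 1) →₀ ℕ) (i j : Fin (n + 1)),
      γ.degree + 2 = k ∧ i < j ∧ r = |secondDiff p k V γ i j|} := by
  refine Set.Finite.bddAbove ?_
  refine (((finite_setOf_degree_eq (ι := Fin (n + 1)) (k - 2)).prod
    (Set.finite_univ (α := Fin (n + 1) × Fin (n + 1)))).image
      (fun x => |secondDiff p k V x.1 x.2.1 x.2.2|)).subset ?_
  rintro r ⟨γ, i, j, hγ, -, rfl⟩
  refine ⟨(γ, i, j), ⟨?_, Set.mem_univ _⟩, rfl⟩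
  simp only [Set.mem_ofPred_eq]
  omega

theorem abs_secondDiff_le {n : ℕ} (p : MvPolynomial (Fin n) ℝ) (k : ℕ)
    (V : RSimplex n) (γ : Fin (n + 1) →₀ ℕ) (hγ : γ.degree + 2 = k) {i j : Fin (n + 1)}
    (hij : i ≠ j) : |secondDiff p k V γ i j| ≤ secondDiffNorm p k V := by
  rcases lt_or_gt_of_ne hij with h | h
  · exact le_csSup (bddAbove_secondDiff p k V) ⟨γ, i, j, hγ, h, rfl⟩
  · rw [secondDiff_comm]
    exact le_csSup (bddAbove_secondDiff p k V) ⟨γ, j, i, hγ, h, rfl⟩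

theorem secondDiffNorm_nonneg {n : ℕ} (p : MvPolynomial (Fin n) ℝ) (k : ℕ) (V : RSimplex n) :
    0 ≤ secondDiffNorm p k V := by
  refine Real.sSup_nonneg ?_
  rintro r ⟨γ, i, j, -, -, rfl⟩
  exact abs_nonneg _

/-- After expanding `(d i - d j)^2`, the pure squares drop out because the `D i` sum to zero. The
point is to remove the diagonal products `D i * D i`, whose second differences `secondDiffNorm` does
not control. -/
theorem two_smul_sum_smul_sq {ι R : Type*} [Fintype ι] [CommRing R] [Algebra ℝ R]
    (d : ι → ℝ) (D : ι → R) (hD : ∑ i, D i = 0) :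
    (2 : ℝ) • (∑ i, d i • D i) ^ 2 = -∑ i, ∑ j, (d i - d j) ^ 2 • (D i * D j) := by
  have h1 : ∑ i, ∑ j, (d i) ^ 2 • (D i * D j) = 0 := by
    refine Finset.sum_eq_zero fun i _ => ?_
    rw [← Finset.smul_sum, ← Finset.mul_sum, hD, mul_zero, smul_zero]
  have h2 : ∑ i, ∑ j, (d j) ^ 2 • (D i * D j) = 0 := by
    rw [Finset.sum_comm]
    refine Finset.sum_eq_zero fun i _ => ?_
    rw [← Finset.smul_sum, ← Finset.sum_mul, hD, zero_mul, smul_zero]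
  have h3 : (∑ i, d i • D i) ^ 2 = ∑ i, ∑ j, (d i * d j) • (D i * D j) := by
    rw [sq, Finset.sum_mul_sum]
    simp only [smul_mul_smul_comm]
  have h4 : ∀ i j, (d i - d j) ^ 2 • (D i * D j) = (d i) ^ 2 • (D i * D j)
      + (d j) ^ 2 • (D i * D j) - (2 : ℝ) • ((d i * d j) • (D i * D j)) := by
    intro i j
    rw [← add_smul, smul_smul, ← sub_smul]
    congr 1
    ring
  simp only [h4, Finset.sum_sub_distrib, Finset.sum_add_distrib, h1, h2, h3, Finset.smul_sum]
  simp

theorem two_mul_bernsteinFunctional_monomial_mul_sum_smul_sq {n : ℕ} (p : MvPolynomial (Fin n) ℝ)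
    (k : ℕ) (V : RSimplex n) (γ : Fin (n + 1) →₀ ℕ) (d : Fin (n + 1) → ℝ) :
    2 * bernsteinFunctional p k V (MvPolynomial.monomial γ 1 *
      (∑ i, d i • (MvPolynomial.X i - MvPolynomial.X (i - 1))) ^ 2)
      = ∑ i, ∑ j, (d i - d j) ^ 2 * secondDiff p k V γ i j := by
  have hD : ∑ i : Fin (n + 1), (MvPolynomial.X i - MvPolynomial.X (i - 1) :
      MvPolynomial (Fin (n + 1)) ℝ) = 0 := by
    rw [Finset.sum_sub_distrib, sub_eq_zero]
    -- The cyclic shift `i ↦ i - 1` is a bijection of the indices.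
    exact (Equiv.sum_comp (Equiv.subRight (1 : Fin (n + 1)))
      (fun i => (MvPolynomial.X i : MvPolynomial (Fin (n + 1)) ℝ))).symm
  rw [← smul_eq_mul, ← map_smul, ← mul_smul_comm, two_smul_sum_smul_sq d _ hD, mul_neg,
    map_neg, Finset.mul_sum, map_sum, ← Finset.sum_neg_distrib]
  refine Finset.sum_congr rfl fun i _ => ?_
  rw [Finset.mul_sum, map_sum, ← Finset.sum_neg_distrib]
  refine Finset.sum_congr rfl fun j _ => ?_
  rw [mul_smul_comm, map_smul, bernsteinFunctional_monomial_mul_sub_mul_sub, smul_eq_mul,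
    mul_neg, neg_neg]

theorem abs_sum_sq_sub_mul_secondDiff_le {n : ℕ} (p : MvPolynomial (Fin n) ℝ)
    {k : ℕ} (V : RSimplex n) (γ : Fin (n + 1) →₀ ℕ) (hγ : γ.degree + 2 = k)
    (d : Fin (n + 1) → ℝ) (B : ℝ) (hd : ∀ i j, (d i - d j) ^ 2 ≤ B) :
    |∑ i, ∑ j, (d i - d j) ^ 2 * secondDiff p k V γ i j|
      ≤ ((n : ℝ) + 1) * (n * (B * secondDiffNorm p k V)) := by
  have hB : 0 ≤ B := (sq_nonneg _).trans (hd 0 0)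
  refine (Finset.abs_sum_le_sum_abs _ _).trans ?_
  refine (Finset.sum_le_card_nsmul _ _ (n * (B * secondDiffNorm p k V)) fun i _ => ?_).trans
    (le_of_eq (by simp))
  -- The diagonal term has weight `0`, which leaves `n` terms for each of the `n + 1` values of `i`.
  rw [← Finset.add_sum_erase _ _ (Finset.mem_univ i), sub_self, zero_pow two_ne_zero, zero_mul,
    zero_add]
  refine (Finset.abs_sum_le_sum_abs _ _).trans ?_
  refine (Finset.sum_le_card_nsmul _ _ (B * secondDiffNorm p k V) fun j hj => ?_).trans
    (le_of_eq (by simp))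
  rw [abs_mul, abs_of_nonneg (sq_nonneg _)]
  exact mul_le_mul (hd i j) (abs_secondDiff_le p k V γ hγ
    (Finset.ne_of_mem_erase hj).symm) (abs_nonneg _) hB

/-- The second derivative of the Bernstein form in the direction `∑ᵢ dᵢ (eᵢ - e_{i-1})`. -/
theorem abs_bernsteinFunctional_mul_sum_smul_sq_le {n : ℕ} (p : MvPolynomial (Fin n) ℝ)
    {k m : ℕ} (hmk : m + 2 = k) (V : RSimplex n) (G : MvPolynomial (Fin (n + 1)) ℝ)
    (hG : IsConvexForm m G) (d : Fin (n + 1) → ℝ) (B : ℝ) (hd : ∀ i j, (d i - d j) ^ 2 ≤ B) :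
    |bernsteinFunctional p k V
      (G * (∑ i, d i • (MvPolynomial.X i - MvPolynomial.X (i - 1))) ^ 2)|
      ≤ (n : ℝ) * (n + 1) / 2 * (B * secondDiffNorm p k V) := by
  have h := hG.abs_apply_le ((bernsteinFunctional p k V).comp (LinearMap.mulRight ℝ
    ((∑ i, d i • (MvPolynomial.X i - MvPolynomial.X (i - 1))) ^ 2)))
    ((n : ℝ) * (n + 1) / 2 * (B * secondDiffNorm p k V)) fun γ hγ => by
      have h2 := abs_sum_sq_sub_mul_secondDiff_le p V γ (hγ.symm ▸ hmk) d B hd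
      rw [← two_mul_bernsteinFunctional_monomial_mul_sum_smul_sq, abs_mul, abs_two] at h2
      rw [LinearMap.comp_apply, LinearMap.mulRight_apply]
      linarith
  rwa [LinearMap.comp_apply, LinearMap.mulRight_apply] at h

/-! ### Displacements in the cyclic directions -/

theorem sum_Iic_succ_sub_castSucc {n : ℕ} {M : Type*} [AddCommGroup M] (f : Fin (n + 1) → M)
    (j : Fin n) : ∑ k ∈ Finset.Iic j, (f k.succ - f k.castSucc) = f j.succ - f 0 := by
  obtain ⟨m, hm⟩ := j
  induction m with
  | zero =>
    have : Finset.Iic (⟨0, hm⟩ : Fin n) = {⟨0, hm⟩} := by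
      ext k
      simp [Fin.le_def, Fin.ext_iff]
    rw [this, Finset.sum_singleton]
    rfl
  | succ m ih =>
    have : Finset.Iic (⟨m + 1, hm⟩ : Fin n) = insert ⟨m + 1, hm⟩ (Finset.Iic ⟨m, by omega⟩) := by
      ext k
      simp only [Finset.mem_Iic, Finset.mem_insert, Fin.le_def, Fin.ext_iff]
      omega
    rw [this, Finset.sum_insert (by simp [Fin.le_def]), ih (by omega)]
    exact sub_add_sub_cancel _ _ _

/-- The coefficients of `∑ⱼ yⱼ (X_{j+1} - X_0)` with respect to the differences `Xᵢ - X_{i-1}`. -/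
noncomputable def cyclicCoeff {n : ℕ} (y : Fin n → ℝ) : Fin (n + 1) → ℝ :=
  Fin.cons 0 (fun k => ∑ j ∈ Finset.Ici k, y j)

/-- Telescope `f j.succ - f 0` and exchange the sums. The cyclic differences are linearly dependent,
so the wrap-around one, at `i = 0`, can be given coefficient `0`. -/
theorem sum_cyclicCoeff_smul {n : ℕ} (y : Fin n → ℝ) {M : Type*} [AddCommGroup M] [Module ℝ M]
    (f : Fin (n + 1) → M) :
    ∑ i, cyclicCoeff y i • (f i - f (i - 1)) = ∑ j, y j • (f j.succ - f 0) := by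
  have h : ∀ k : Fin n, k.succ - 1 = k.castSucc := fun k => by
    rw [sub_eq_iff_eq_add, Fin.coeSucc_eq_succ]
  simp only [← sum_Iic_succ_sub_castSucc f, Fin.sum_univ_succ, cyclicCoeff, Fin.cons_zero,
    zero_smul, zero_add, Fin.cons_succ, h, Finset.sum_smul, Finset.smul_sum]
  exact Finset.sum_comm' (by simp)

theorem sq_sum_finset_le {n : ℕ} (y : Fin n → ℝ) (T : Finset (Fin n)) :
    (∑ j ∈ T, y j) ^ 2 ≤ n * ∑ j, y j ^ 2 := by
  refine (sq_sum_le_card_mul_sum_sq (s := T) (f := y)).trans ?_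
  refine mul_le_mul ?_ ?_ (Finset.sum_nonneg fun _ _ => sq_nonneg _) (Nat.cast_nonneg _)
  · exact_mod_cast (Finset.card_le_univ T).trans (by simp)
  · exact Finset.sum_le_sum_of_subset_of_nonneg (Finset.subset_univ _) fun _ _ _ => sq_nonneg _

/-- A difference of two tail sums is, up to sign, a sum of `y` over at most `n` indices;
Cauchy–Schwarz does the rest. -/
theorem sq_cyclicCoeff_sub_le {n : ℕ} (y : Fin n → ℝ) (i j : Fin (n + 1)) :
    (cyclicCoeff y i - cyclicCoeff y j) ^ 2 ≤ n * ∑ j, y j ^ 2 := by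
  have hmono : ∀ a b : Fin n, a ≤ b →
      (∑ j ∈ Finset.Ici a, y j - ∑ j ∈ Finset.Ici b, y j) ^ 2 ≤ n * ∑ j, y j ^ 2 := by
    intro a b hab
    rw [← Finset.sum_sdiff (Finset.Ici_subset_Ici.2 hab), add_sub_cancel_right]
    exact sq_sum_finset_le _ _
  refine Fin.cases ?_ (fun a => ?_) i <;> refine Fin.cases ?_ (fun b => ?_) j
  · simp only [sub_self, ne_eq, OfNat.ofNat_ne_zero, not_false_eq_true, zero_pow]
    exact mul_nonneg (Nat.cast_nonneg _) (Finset.sum_nonneg fun _ _ => sq_nonneg _)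
  · simpa [cyclicCoeff] using sq_sum_finset_le y (Finset.Ici b)
  · simpa [cyclicCoeff] using sq_sum_finset_le y (Finset.Ici a)
  · simp only [cyclicCoeff, Fin.cons_succ]
    rcases le_total a b with h | h
    · exact hmono a b h
    · rw [sub_sq_comm]
      exact hmono b a h

theorem abs_bernsteinFunctional_mul_pointForm_sub_sq_le {n : ℕ} (p : MvPolynomial (Fin n) ℝ)
    {k m : ℕ} (hmk : m + 2 = k) (V : RSimplex n) (G : MvPolynomial (Fin (n + 1)) ℝ)
    (hG : IsConvexForm m G) (x y : EuclideanSpace ℝ (Fin n)) :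
    |bernsteinFunctional p k V (G * (pointForm x - pointForm y) ^ 2)|
      ≤ (n : ℝ) ^ 2 * (n + 1) / 2 * (dist x y ^ 2 * secondDiffNorm p k V) := by
  have hu : pointForm x - pointForm y = ∑ i, cyclicCoeff (fun j => x j - y j) i •
      (MvPolynomial.X i - MvPolynomial.X (i - 1) : MvPolynomial (Fin (n + 1)) ℝ) := by
    rw [sum_cyclicCoeff_smul, pointForm, pointForm, add_sub_add_left_eq_sub,
      ← Finset.sum_sub_distrib]
    simp only [sub_smul]
  rw [hu]
  refine (abs_bernsteinFunctional_mul_sum_smul_sq_le p hmk V G hG _ _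
    (sq_cyclicCoeff_sub_le _)).trans (le_of_eq ?_)
  rw [EuclideanSpace.dist_eq, Real.sq_sqrt (Finset.sum_nonneg fun _ _ => sq_nonneg _)]
  simp only [Real.dist_eq, sq_abs]
  ring

/-! ### Bernstein coefficients versus grid values -/

theorem sum_div_eq_one {n l : ℕ} (hl : 1 ≤ l) (α : Fin (n + 1) →₀ ℕ) (hα : α.degree = l) :
    ∑ i, (α i : ℝ) / (l : ℝ) = 1 := by
  have hl0 : (l : ℝ) ≠ 0 := by exact_mod_cast (by omega : l ≠ 0)
  rw [← Finset.sum_div, div_eq_one_iff_eq hl0, ← hα, Finsupp.degree_eq_sum]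
  push_cast
  rfl

theorem isConvexForm_pointForm_gridPoint {n l : ℕ} (hl : 1 ≤ l) (V : RSimplex n)
    (hV : ∀ i, IsConvexForm 1 (pointForm (V.points i))) (α : Fin (n + 1) →₀ ℕ)
    (hα : α.degree = l) : IsConvexForm 1 (pointForm (gridPoint l V α)) := by
  rw [gridPoint, pointForm_sum_smul _ (sum_div_eq_one hl α hα)]
  exact IsConvexForm.sum_smul _ (fun i => by positivity) (sum_div_eq_one hl α hα) _ hV

theorem isConvexForm_prod_pointForm {n l : ℕ} (V : RSimplex n)
    (hV : ∀ i, IsConvexForm 1 (pointForm (V.points i))) (α : Fin (n + 1) →₀ ℕ)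
    (hα : α.degree = l) : IsConvexForm l (∏ i, pointForm (V.points i) ^ α i) := by
  have h := IsConvexForm.prod (Finset.univ : Finset (Σ i, Fin (α i)))
    (fun x => pointForm (V.points x.1)) fun x _ => hV x.1
  rw [Fintype.prod_sigma, Finset.card_univ, Fintype.card_sigma] at h
  simpa [← Finsupp.degree_eq_sum, hα] using h

/-- The distance between the Bernstein coefficients over a simplex inside the standard one and the
values at the grid points, in terms of the second differences over the standard simplex. -/
theorem abs_bernsteinCoeff_sub_evalAt_gridPoint_le {n l : ℕ} (hl : 1 ≤ l)
    (p : MvPolynomial (Fin n) ℝ) (hp : p.totalDegree ≤ l) (V : RSimplex n)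
    (hV : ∀ i, IsConvexForm 1 (pointForm (V.points i))) (H : ℝ)
    (hH : ∀ i j, dist (V.points i) (V.points j) ^ 2 ≤ H)
    (α : Fin (n + 1) →₀ ℕ) (hα : α.degree = l) :
    |bernsteinCoeff p l V α - evalAt p (gridPoint l V α)|
      ≤ ((l : ℝ) - 1) / 4 *
        ((n : ℝ) ^ 2 * (n + 1) / 2 * (H * secondDiffNorm p l (stdRSimplex n))) := by
  have hl0 : (l : ℝ) ≠ 0 := by exact_mod_cast (by omega : l ≠ 0)
  -- The index type contains `α i` copies of each vertex index `i`, hence one index for each of the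
  -- `l` linear factors.
  have hcard : Fintype.card (Σ i, Fin (α i)) = l := by
    simp [← hα, Finsupp.degree_eq_sum]
  have : Nonempty (Σ i, Fin (α i)) := Fintype.card_pos_iff.1 (by omega)
  have hsum : ∑ x : (Σ i, Fin (α i)), pointForm (V.points x.1)
      = (Fintype.card (Σ i, Fin (α i)) : ℝ) • pointForm (gridPoint l V α) := by
    rw [hcard, gridPoint, pointForm_sum_smul _ (sum_div_eq_one hl α hα), Fintype.sum_sigma,
      Finset.smul_sum]
    refine Finset.sum_congr rfl fun i _ => ?_
    simp [smul_smul, mul_div_cancel₀ _ hl0, Nat.cast_smul_eq_nsmul]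
  have h := abs_apply_prod_sub_pow_le (bernsteinFunctional p l (stdRSimplex n))
    (fun x : (Σ i, Fin (α i)) => pointForm (V.points x.1)) (fun x => hV x.1) _
    (isConvexForm_pointForm_gridPoint hl V hV α hα) hsum
    ((n : ℝ) ^ 2 * (n + 1) / 2 * (H * secondDiffNorm p l (stdRSimplex n)))
    (fun k G i j hk hG => by
      refine (abs_bernsteinFunctional_mul_pointForm_sub_sq_le p (hk.trans hcard) _ G hG
        _ _).trans ?_
      have := secondDiffNorm_nonneg p l (stdRSimplex n)
      gcongr
      exact hH _ _)
  have hprod : ∏ x : (Σ i, Fin (α i)), pointForm (V.points x.1)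
      = ∏ i, pointForm (V.points i) ^ α i := by
    simp [Fintype.prod_sigma]
  rwa [hprod, hcard, bernsteinFunctional_prod_pointForm p l hp V α hα,
    bernsteinFunctional_pointForm_pow p l hp] at h

/-! ### The mesh under subdivision and the diameter of the standard simplex -/

theorem isBounded_realization {n : ℕ} (V : RSimplex n) : Bornology.IsBounded V.realization :=
  isBounded_convexHull.2 (Set.finite_range _).isBounded

theorem points_mem_realization {n : ℕ} (V : RSimplex n) (i : Fin (n + 1)) :
    V.points i ∈ V.realization :=
  subset_convexHull ℝ _ (Set.mem_range_self i)

theorem dist_points_le_mesh {n : ℕ} (V : RSimplex n) (i j : Fin (n + 1)) :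
    dist (V.points i) (V.points j) ≤ V.mesh :=
  Metric.dist_le_diam_of_mem (isBounded_realization V) (points_mem_realization V i)
    (points_mem_realization V j)

theorem SubdivisionScheme.realization_subset_of_mem_iter {n : ℕ} (S : SubdivisionScheme n)
    (N : ℕ) (V U : RSimplex n) (hU : U ∈ S.iter N V) : U.realization ⊆ V.realization := by
  induction N generalizing U with
  | zero =>
    rw [List.mem_singleton.1 hU]
  | succ N ih =>
    obtain ⟨W, hW, hUW⟩ := List.mem_flatMap.1 hU
    refine subset_trans ?_ (ih W hW)
    rw [← (S.isSubdivision W).1]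
    exact Set.subset_biUnion_of_mem (u := fun U : RSimplex n => U.realization) hUW

theorem SubdivisionScheme.HasShrinkingFactor.mesh_le_of_mem_iter {n : ℕ} {S : SubdivisionScheme n}
    {C : ℝ} (hC : S.HasShrinkingFactor C) (N : ℕ) (V U : RSimplex n) (hU : U ∈ S.iter N V) :
    U.mesh ≤ C ^ N * V.mesh := by
  induction N generalizing U with
  | zero =>
    rw [List.mem_singleton.1 hU, pow_zero, one_mul]
  | succ N ih =>
    obtain ⟨W, hW, hUW⟩ := List.mem_flatMap.1 hU
    calc U.mesh ≤ C * W.mesh := hC.2.2 W U hUW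
      _ ≤ C * (C ^ N * V.mesh) := mul_le_mul_of_nonneg_left (ih W hW) hC.1.le
      _ = C ^ (N + 1) * V.mesh := by ring

/-- The diameter of a convex hull is that of its vertices. Their coordinates are `0` or `1` with sum
at most `1`, so each squared coordinate difference is at most the sum of the two coordinates, and
also at most `1`. -/
theorem mesh_stdRSimplex_sq_le (n : ℕ) : (stdRSimplex n).mesh ^ 2 ≤ min 2 (n : ℝ) := by
  have h01 : ∀ i k, stdVertex n i k = 0 ∨ stdVertex n i k = 1 := by
    intro i k
    refine Fin.cases ?_ (fun j => ?_) i
    · simp [stdVertex]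
    · by_cases h : k = j <;> simp [stdVertex, h]
  have hsum : ∀ i, ∑ k, stdVertex n i k ≤ 1 := by
    intro i
    refine Fin.cases ?_ (fun j => ?_) i
    · simp [stdVertex]
    · simp [stdVertex]
  have hdist : ∀ i j, dist (stdVertex n i) (stdVertex n j) ≤ √(min 2 (n : ℝ)) := by
    intro i j
    rw [EuclideanSpace.dist_eq]
    refine Real.sqrt_le_sqrt (le_min ?_ ?_)
    · calc ∑ k, dist (stdVertex n i k) (stdVertex n j k) ^ 2
          ≤ ∑ k, (stdVertex n i k + stdVertex n j k) := Finset.sum_le_sum fun k _ => by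
            rcases h01 i k with h | h <;> rcases h01 j k with h' | h' <;> norm_num [h, h']
        _ ≤ 2 := by rw [Finset.sum_add_distrib]; linarith [hsum i, hsum j]
    · refine (Finset.sum_le_card_nsmul _ _ 1 fun k _ => ?_).trans (le_of_eq (by simp))
      rcases h01 i k with h | h <;> rcases h01 j k with h' | h' <;> norm_num [h, h']
  have h : (stdRSimplex n).mesh ≤ √(min 2 (n : ℝ)) := by
    rw [RSimplex.mesh, RSimplex.realization, convexHull_diam]
    refine Metric.diam_le_of_forall_dist_le (Real.sqrt_nonneg _) ?_
    rintro _ ⟨i, rfl⟩ _ ⟨j, rfl⟩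
    exact hdist i j
  have h2 := pow_le_pow_left₀ Metric.diam_nonneg h 2
  rwa [Real.sq_sqrt (by positivity)] at h2

/-- This is the numerical inequality behind `576 = 2 * 288 = 2 * 8 * 36` in `omegaPrime`. For `n =
1` both sides of the estimate become `36`, which needs the bound `n` on the squared diameter; for `n
≥ 2` the bound `2` suffices, since `72 ≤ 80`. -/
theorem mul_mesh_stdRSimplex_sq_le {n : ℕ} (hn : 1 ≤ n) :
    36 * (stdRSimplex n).mesh ^ 2 ≤ ((n : ℝ) + 2) ^ 2 * (n + 3) := by
  have h := mesh_stdRSimplex_sq_le n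
  rcases hn.eq_or_lt with rfl | hn
  · norm_num at h ⊢
    linarith
  · have h2 : (2 : ℝ) ≤ n := by exact_mod_cast hn
    have h3 : (stdRSimplex n).mesh ^ 2 ≤ 2 := h.trans (min_le_left _ _)
    nlinarith [mul_nonneg (sub_nonneg.2 h2) (sub_nonneg.2 h2)]

theorem single_degree {n : ℕ} (i : Fin (n + 1)) (l : ℕ) :
    (Finsupp.single i l : Fin (n + 1) →₀ ℕ).degree = l := by
  simp

/-! ### Enclosure and error for rational Bernstein coefficients -/

section Gap

variable {n l : ℕ} {p q : MvPolynomial (Fin n) ℝ} {V : RSimplex n}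

theorem sInf_bernsteinCoeff_le (q : MvPolynomial (Fin n) ℝ) (V : RSimplex n)
    {α : Fin (n + 1) →₀ ℕ} (hα : α.degree = l) :
    sInf (bernsteinCoeff q l V '' {α | α.degree = l}) ≤ bernsteinCoeff q l V α :=
  csInf_le ((finite_setOf_degree_eq l).image _).bddBelow ⟨α, hα, rfl⟩

theorem sInf_bernsteinCoeff_pos
    (hpos : ∀ α : Fin (n + 1) →₀ ℕ, α.degree = l → 0 < bernsteinCoeff q l V α) :
    0 < sInf (bernsteinCoeff q l V '' {α | α.degree = l}) := by
  obtain ⟨α, hα, h⟩ := Set.Nonempty.csInf_mem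
    (⟨_, Finsupp.single 0 l, single_degree 0 l, rfl⟩ :
      (bernsteinCoeff q l V '' {α | α.degree = l}).Nonempty)
    ((finite_setOf_degree_eq l).image _)
  rw [← h]
  exact hpos α hα

/-- A convex form of degree `l` has the same enclosure under the Bernstein functional of `q` as the
monomials. -/
theorem sInf_bernsteinCoeff_le_bernsteinFunctional {G : MvPolynomial (Fin (n + 1)) ℝ}
    (hG : IsConvexForm l G) (q : MvPolynomial (Fin n) ℝ) (V : RSimplex n) :
    sInf (bernsteinCoeff q l V '' {α | α.degree = l}) ≤ bernsteinFunctional q l V G :=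
  hG.le_apply _ _ fun γ hγ => by
    rw [bernsteinFunctional_monomial, one_mul]
    exact sInf_bernsteinCoeff_le q V hγ

/-- If `a` is the least rational coefficient over the standard simplex, then `Λ_p - a Λ_q` is
nonnegative on monomials of degree `l`, hence on the convex form that represents the coefficient
over `V`. The greatest one is treated with reversed signs. -/
theorem abs_ratBernsteinCoeff_le_zetaConst (hp : p.totalDegree ≤ l) (hq : q.totalDegree ≤ l)
    (hpos : ∀ α : Fin (n + 1) →₀ ℕ, α.degree = l → 0 < bernsteinCoeff q l (stdRSimplex n) α)
    (hV : ∀ i, IsConvexForm 1 (pointForm (V.points i)))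
    {α : Fin (n + 1) →₀ ℕ} (hα : α.degree = l) :
    |ratBernsteinCoeff p q l V α| ≤ zetaConst p q l := by
  have hG := isConvexForm_prod_pointForm V hV α hα
  have hqV : 0 < bernsteinCoeff q l V α := by
    rw [← bernsteinFunctional_prod_pointForm q l hq V α hα]
    exact (sInf_bernsteinCoeff_pos hpos).trans_le
      (sInf_bernsteinCoeff_le_bernsteinFunctional hG q _)
  have hfin := (finite_setOf_degree_eq (ι := Fin (n + 1)) l).image
    (ratBernsteinCoeff p q l (stdRSimplex n))
  refine abs_le_max_abs_abs ?_ ?_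
  · set a := sInf (ratBernsteinCoeff p q l (stdRSimplex n) '' {α | α.degree = l})
    have h := hG.le_apply (bernsteinFunctional p l (stdRSimplex n)
      - a • bernsteinFunctional q l (stdRSimplex n)) 0 fun γ hγ => by
        have h1 : a ≤ ratBernsteinCoeff p q l (stdRSimplex n) γ :=
          csInf_le hfin.bddBelow ⟨γ, hγ, rfl⟩
        rw [ratBernsteinCoeff, le_div_iff₀ (hpos γ hγ)] at h1
        simpa [bernsteinFunctional_monomial] using h1
    rw [ratBernsteinCoeff, le_div_iff₀ hqV]
    simpa [bernsteinFunctional_prod_pointForm, hp, hq, hα] using h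
  · set a := sSup (ratBernsteinCoeff p q l (stdRSimplex n) '' {α | α.degree = l})
    have h := hG.le_apply (a • bernsteinFunctional q l (stdRSimplex n)
      - bernsteinFunctional p l (stdRSimplex n)) 0 fun γ hγ => by
        have h1 : ratBernsteinCoeff p q l (stdRSimplex n) γ ≤ a :=
          le_csSup hfin.bddAbove ⟨γ, hγ, rfl⟩
        rw [ratBernsteinCoeff, div_le_iff₀ (hpos γ hγ)] at h1
        simpa [bernsteinFunctional_monomial] using h1
    rw [ratBernsteinCoeff, div_le_iff₀ hqV]
    simpa [bernsteinFunctional_prod_pointForm, hp, hq, hα] using h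

/-- The distance between the rational Bernstein coefficients over a simplex inside the standard one
and the values at the grid points. -/
theorem abs_evalAt_div_sub_ratBernsteinCoeff_le (hl : 1 ≤ l)
    (hp : p.totalDegree ≤ l) (hq : q.totalDegree ≤ l)
    (hpos : ∀ α : Fin (n + 1) →₀ ℕ, α.degree = l → 0 < bernsteinCoeff q l (stdRSimplex n) α)
    (hV : ∀ i, IsConvexForm 1 (pointForm (V.points i))) {H : ℝ}
    (hH : ∀ i j, dist (V.points i) (V.points j) ^ 2 ≤ H)
    {α : Fin (n + 1) →₀ ℕ} (hα : α.degree = l) :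
    |evalAt p (gridPoint l V α) / evalAt q (gridPoint l V α) - ratBernsteinCoeff p q l V α|
      ≤ ((l : ℝ) - 1) / 4 * ((n : ℝ) ^ 2 * (n + 1) / 2 * (H *
        (secondDiffNorm p l (stdRSimplex n)
          + zetaConst p q l * secondDiffNorm q l (stdRSimplex n)))) /
        sInf (bernsteinCoeff q l (stdRSimplex n) '' {α | α.degree = l}) := by
  set b := sInf (bernsteinCoeff q l (stdRSimplex n) '' {α | α.degree = l})
  have hb : 0 < b := sInf_bernsteinCoeff_pos hpos
  have hqx : b ≤ evalAt q (gridPoint l V α) := by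
    rw [← bernsteinFunctional_pointForm_pow q l hq]
    exact sInf_bernsteinCoeff_le_bernsteinFunctional
      ((isConvexForm_pointForm_gridPoint hl V hV α hα).pow l) q _
  have hqV : 0 < bernsteinCoeff q l V α := by
    rw [← bernsteinFunctional_prod_pointForm q l hq V α hα]
    exact hb.trans_le (sInf_bernsteinCoeff_le_bernsteinFunctional
      (isConvexForm_prod_pointForm V hV α hα) q _)
  have hz := abs_ratBernsteinCoeff_le_zetaConst hp hq hpos hV hα
  have hP := abs_bernsteinCoeff_sub_evalAt_gridPoint_le hl p hp V hV H hH α hα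
  have hQ := abs_bernsteinCoeff_sub_evalAt_gridPoint_le hl q hq V hV H hH α hα
  set x := gridPoint l V α
  have hqx0 : 0 < evalAt q x := hb.trans_le hqx
  -- Splitting off the rational coefficient, rather than the value of `f`, lets `ζ` bound the factor
  -- in front of the error of `q`.
  have heq : evalAt p x / evalAt q x - ratBernsteinCoeff p q l V α =
      (ratBernsteinCoeff p q l V α * (bernsteinCoeff q l V α - evalAt q x)
        - (bernsteinCoeff p l V α - evalAt p x)) / evalAt q x := by
    rw [ratBernsteinCoeff]
    field_simp
    ring
  rw [heq, abs_div, abs_of_pos hqx0]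
  have hnum : |ratBernsteinCoeff p q l V α * (bernsteinCoeff q l V α - evalAt q x)
        - (bernsteinCoeff p l V α - evalAt p x)| ≤
      ((l : ℝ) - 1) / 4 * ((n : ℝ) ^ 2 * (n + 1) / 2 * (H *
        (secondDiffNorm p l (stdRSimplex n)
          + zetaConst p q l * secondDiffNorm q l (stdRSimplex n)))) := by
    refine (abs_sub _ _).trans ?_
    rw [abs_mul]
    refine (add_le_add (mul_le_mul hz hQ (abs_nonneg _) ((abs_nonneg _).trans hz)) hP).trans
      (le_of_eq ?_)
    ring
  exact div_le_div₀ ((abs_nonneg _).trans hnum) hnum hb hqx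

theorem minCoeff_le_ratBernsteinCoeff (p q : MvPolynomial (Fin n) ℝ) {L : List (RSimplex n)}
    (hV : V ∈ L) {α : Fin (n + 1) →₀ ℕ} (hα : α.degree = l) :
    minCoeff p q l L ≤ ratBernsteinCoeff p q l V α := by
  classical
  refine csInf_le (Set.Finite.bddBelow ?_) ⟨V, hV, α, hα, rfl⟩
  refine ((L.toFinset.finite_toSet.prod (finite_setOf_degree_eq (ι := Fin (n + 1)) l)).image
    fun x => ratBernsteinCoeff p q l x.1 x.2).subset ?_
  rintro r ⟨U, hU, β, hβ, rfl⟩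
  exact ⟨(U, β), ⟨by simpa using hU, hβ⟩, rfl⟩

/-- With `m` the minimal coefficient, `b_β(p) ≥ m b_β(q)` for all `β`. Summing against the
nonnegative Bernstein polynomials gives `p(x) ≥ m q(x)` at the grid point; the vertex terms are
themselves among the coefficients. -/
theorem minCoeff_le_upperEstimate (hl : 1 ≤ l)
    (hp : p.totalDegree ≤ l) (hq : q.totalDegree ≤ l) {L : List (RSimplex n)} (hVL : V ∈ L)
    (hpos : ∀ α : Fin (n + 1) →₀ ℕ, α.degree = l → 0 < bernsteinCoeff q l V α)
    {α : Fin (n + 1) →₀ ℕ} (hα : α.degree = l)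
    (hx : 0 < evalAt q (gridPoint l V α)) :
    minCoeff p q l L ≤ upperEstimate p q l L V α := by
  refine le_min ?_ (le_csInf ⟨_, V, hVL, 0, rfl⟩ ?_)
  · rw [le_div_iff₀ hx, gridPoint, bernstein_expansion p l hp V _ (sum_div_eq_one hl α hα),
      bernstein_expansion q l hq V _ (sum_div_eq_one hl α hα), Finset.mul_sum]
    refine Finset.sum_le_sum fun β hβ => ?_
    have hβ := (mem_antidiag_iff β).1 hβ
    rw [← mul_assoc]
    refine mul_le_mul_of_nonneg_right ?_ (by unfold bernsteinPoly; positivity)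
    rw [← le_div_iff₀ (hpos β hβ)]
    exact minCoeff_le_ratBernsteinCoeff p q hVL hβ
  · rintro r ⟨U, hU, i, rfl⟩
    exact minCoeff_le_ratBernsteinCoeff p q hU (single_degree i l)

end Gap

/-! ### The gap after `N` subdivision steps -/

theorem abs_evalAt_div_sub_ratBernsteinCoeff_lt_of_mem_iter {n : ℕ} (hn : 1 ≤ n) {l : ℕ}
    (hl : 1 ≤ l) {p q : MvPolynomial (Fin n) ℝ}
    (hp : p.totalDegree ≤ l) (hq : q.totalDegree ≤ l)
    (hpos : ∀ α : Fin (n + 1) →₀ ℕ, α.degree = l → 0 < bernsteinCoeff q l (stdRSimplex n) α)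
    {S : SubdivisionScheme n} {C : ℝ} (hC : S.HasShrinkingFactor C)
    {ε : ℝ} (hε : 0 < ε) {N : ℕ} (hN : 1 / C ^ (2 * N) > 2 * omegaPrime p q l / ε)
    {V : RSimplex n} (hVS : V ∈ S.iter N (stdRSimplex n))
    (hV : ∀ i, IsConvexForm 1 (pointForm (V.points i)))
    {α : Fin (n + 1) →₀ ℕ} (hα : α.degree = l) :
    |evalAt p (gridPoint l V α) / evalAt q (gridPoint l V α) - ratBernsteinCoeff p q l V α|
      < ε := by
  have hC0 : 0 < C ^ (2 * N) := pow_pos hC.1 _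
  rw [gt_iff_lt, div_lt_div_iff₀ hε hC0, one_mul] at hN
  have hH : ∀ i j, dist (V.points i) (V.points j) ^ 2
      ≤ C ^ (2 * N) * (stdRSimplex n).mesh ^ 2 := by
    intro i j
    rw [mul_comm 2 N, pow_mul, ← mul_pow]
    exact pow_le_pow_left₀ dist_nonneg
      ((dist_points_le_mesh V i j).trans (hC.mesh_le_of_mem_iter N _ V hVS)) 2
  refine (abs_evalAt_div_sub_ratBernsteinCoeff_le hl hp hq hpos hV hH hα).trans_lt
    (lt_of_le_of_lt ?_ hN)
  have hb := sInf_bernsteinCoeff_pos hpos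
  have hz : 0 ≤ zetaConst p q l := (abs_nonneg _).trans (le_max_left _ _)
  have hW : 0 ≤ secondDiffNorm p l (stdRSimplex n)
      + zetaConst p q l * secondDiffNorm q l (stdRSimplex n) :=
    add_nonneg (secondDiffNorm_nonneg _ _ _) (mul_nonneg hz (secondDiffNorm_nonneg _ _ _))
  unfold omegaPrime
  set b := sInf (bernsteinCoeff q l (stdRSimplex n) '' {α | α.degree = l})
  set W := secondDiffNorm p l (stdRSimplex n)
    + zetaConst p q l * secondDiffNorm q l (stdRSimplex n)
  have hl1 : (0 : ℝ) ≤ (l : ℝ) - 1 := sub_nonneg.2 (by exact_mod_cast hl)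
  have hm := mul_mesh_stdRSimplex_sq_le hn
  set μ := (stdRSimplex n).mesh ^ 2
  -- The factor `8 = 4 * 2` is written as `288 / 36`; then `l - 1` is enlarged to `l` and `36 μ` to
  -- `(n+2)^2 (n+3)`. The result is exactly `2 ω' C^(2N)`.
  calc ((l : ℝ) - 1) / 4 * ((n : ℝ) ^ 2 * (n + 1) / 2 * (C ^ (2 * N) * μ * W)) / b
      = ((l : ℝ) - 1) * (36 * μ) * ((n : ℝ) ^ 2 * (n + 1) * C ^ (2 * N) * W / (288 * b)) := by
        field_simp
        ring
    _ ≤ (l : ℝ) * (((n : ℝ) + 2) ^ 2 * (n + 3)) *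
        ((n : ℝ) ^ 2 * (n + 1) * C ^ (2 * N) * W / (288 * b)) := by
        gcongr
        linarith
    _ = 2 * ((l : ℝ) * (((n : ℝ) ^ 2 * ((n : ℝ) + 1) * ((n : ℝ) + 2) ^ 2 * ((n : ℝ) + 3)) /
      (576 * b)) * W) * C ^ (2 * N) := by
        field_simp
        ring

theorem theorem4p4 (n : ℕ) (hn : 1 ≤ n) (l : ℕ) (hl : 1 ≤ l)
    (p q : MvPolynomial (Fin n) ℝ) (hp : p.totalDegree ≤ l) (hq : q.totalDegree ≤ l)
    (hpos : ∀ α : Fin (n + 1) →₀ ℕ, α.degree = l → 0 < bernsteinCoeff q l (stdRSimplex n) α)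
    (S : SubdivisionScheme n) (C : ℝ) (hC : S.HasShrinkingFactor C)
    (ε : ℝ) (hε : 0 < ε) (N : ℕ) (hN : 1 / C ^ (2 * N) > 2 * omegaPrime p q l / ε) :
    -- the gap for the whole list of subsimplices
    (∀ V ∈ S.iter N (stdRSimplex n), ∀ α : Fin (n + 1) →₀ ℕ, α.degree = l →
      ratBernsteinCoeff p q l V α = minCoeff p q l (S.iter N (stdRSimplex n)) →
      |upperEstimate p q l (S.iter N (stdRSimplex n)) V α
        - minCoeff p q l (S.iter N (stdRSimplex n))| < ε) ∧
    -- the gap on each single subsimplex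
    (∀ V ∈ S.iter N (stdRSimplex n), ∀ α : Fin (n + 1) →₀ ℕ, α.degree = l →
      ratBernsteinCoeff p q l V α = minCoeff p q l [V] →
      |upperEstimate p q l [V] V α - minCoeff p q l [V]| < ε) := by
  -- Only membership of the minimizing simplex in `S^N(Δ)` matters, so the whole list and the
  -- one-element lists are handled together.
  have key : ∀ L : List (RSimplex n), ∀ V ∈ L, V ∈ S.iter N (stdRSimplex n) →
      ∀ α : Fin (n + 1) →₀ ℕ, α.degree = l → ratBernsteinCoeff p q l V α = minCoeff p q l L →
      |upperEstimate p q l L V α - minCoeff p q l L| < ε := by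
    intro L V hVL hVS α hα hmin
    have hV : ∀ i, IsConvexForm 1 (pointForm (V.points i)) := fun i =>
      isConvexForm_pointForm _ (S.realization_subset_of_mem_iter N _ V hVS
        (points_mem_realization V i))
    have hb := sInf_bernsteinCoeff_pos hpos
    have hlow : minCoeff p q l L ≤ upperEstimate p q l L V α := by
      refine minCoeff_le_upperEstimate hl hp hq hVL (fun β hβ => ?_) hα ?_
      · rw [← bernsteinFunctional_prod_pointForm q l hq V β hβ]
        exact hb.trans_le (sInf_bernsteinCoeff_le_bernsteinFunctional
          (isConvexForm_prod_pointForm V hV β hβ) q _)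
      · rw [← bernsteinFunctional_pointForm_pow q l hq]
        exact hb.trans_le (sInf_bernsteinCoeff_le_bernsteinFunctional
          ((isConvexForm_pointForm_gridPoint hl V hV α hα).pow l) q _)
    have hgap := abs_evalAt_div_sub_ratBernsteinCoeff_lt_of_mem_iter hn hl hp hq hpos hC hε hN
      hVS hV hα
    rw [abs_of_nonneg (sub_nonneg.2 hlow), ← hmin]
    exact (sub_le_sub_right (min_le_left _ _) _).trans_lt ((le_abs_self _).trans_lt hgap)
  exact ⟨fun V hV => key _ V hV hV, fun V hV => key [V] V (List.mem_singleton_self V) hV⟩
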